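/- Let $k$ be a field, $1\le a\le b\le n$ integers and $S=k[x_1,\ldots,x_n]$ with its standard grading, and order monomials lexicographically with $x_1>x_2>\cdots>x_n$. Let $L(a,b)\subseteq S$ be the ideal generated by all squarefree monomials of degree $2$ in the variables $x_1,\ldots,x_b$ that are lexicographically larger than or equal to $x_ax_b$ (so for $n=b$ it is generated by all squarefree monomials of degree $2$ in $S$ that are larger than or equal to $x_ax_b$). Let $\beta_{i,j}=\dim_k\operatorname{Tor}^S_i(S/L(a,b),k)_j$ denote the graded Betti numbers of $S/L(a,b)$. Then $$\beta_{i,i+1}=a\binom{b}{i+1}-a\binom{b-1}{i+1}-\binom{a}{i+1}\qquad\text{for } 1\le i\le b-1,$$ $\beta_{0,0}=1$, and all other $\beta_{i,j}$ are zero. -/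

import Mathlib

open scoped TensorProduct

/-- The field `k` as a module over `S = k[x₁, …, xₙ]`, every variable acting as zero. -/
def ResidueModule (k : Type*) [Field k] (_n : ℕ) : Type _ := k

noncomputable instance (k : Type*) [Field k] (n : ℕ) : AddCommGroup (ResidueModule k n) :=
  inferInstanceAs (AddCommGroup k)

noncomputable instance (k : Type*) [Field k] (n : ℕ) : Module k (ResidueModule k n) :=
  inferInstanceAs (Module k k)

noncomputable instance (k : Type*) [Field k] (n : ℕ) :
    Module (MvPolynomial (Fin n) k) (ResidueModule k n) :=
  Module.compHom k (MvPolynomial.constantCoeff : MvPolynomial (Fin n) k →+* k)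

theorem ResidueModule.smul_def {k : Type*} [Field k] {n : ℕ} (p : MvPolynomial (Fin n) k)
    (c : ResidueModule k n) : p • c = MvPolynomial.constantCoeff p • c := rfl

instance (k : Type*) [Field k] (n : ℕ) :
    IsScalarTower k (MvPolynomial (Fin n) k) (ResidueModule k n) where
  smul_assoc c p z := by
    rw [ResidueModule.smul_def, ResidueModule.smul_def, MvPolynomial.smul_eq_C_mul, map_mul,
      MvPolynomial.constantCoeff_C, mul_smul]

/-- The unit element of the field `k`, viewed as an `S`-module. -/
def ResidueModule.one (k : Type*) [Field k] (n : ℕ) : ResidueModule k n := (1 : k)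

/-- The degree `m` part of the graded free module `⨁ₑ S(-deg e)`: vectors whose entry at `e` is
homogeneous of degree `m - deg e` (and zero if `m < deg e`). -/
def freeDegree {k : Type*} [Field k] {n r : ℕ} (deg : Fin r → ℕ) (m : ℕ) :
    Submodule k (Fin r → MvPolynomial (Fin n) k) where
  carrier := {v | ∀ e, ∀ s ∈ (v e).support, s.degree + deg e = m}
  zero_mem' := by intro e s hs; simp at hs
  add_mem' := by
    classical
    intro v w hv hw e s hs
    rcases Finset.mem_union.1 (MvPolynomial.support_add hs) with h | h
    · exact hv e s h
    · exact hw e s h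
  smul_mem' := by
    intro c v hv e s hs
    exact hv e s (MvPolynomial.support_smul hs)

/-- The degree `m` part of `S ⧸ I`: the classes of homogeneous polynomials of degree `m`. -/
noncomputable def quotientDegree {k : Type*} [Field k] {n : ℕ}
    (I : Ideal (MvPolynomial (Fin n) k)) (m : ℕ) :
    Submodule k (MvPolynomial (Fin n) k ⧸ I) :=
  (MvPolynomial.homogeneousSubmodule (Fin n) k m).map (Ideal.Quotient.mkₐ k I).toLinearMap

/-- A graded free resolution `… → F₂ → F₁ → F₀ → S ⧸ I → 0` of `S ⧸ I` over
`S = k[x₁, …, xₙ]` by finitely generated graded free modules `Fᵢ = ⨁ₑ S(-deg i e)`, with all maps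
homogeneous of degree zero. -/
structure GradedFreeResolution {k : Type*} [Field k] {n : ℕ}
    (I : Ideal (MvPolynomial (Fin n) k)) where
  rank : ℕ → ℕ
  deg : ∀ i, Fin (rank i) → ℕ
  d : ∀ i, (Fin (rank (i + 1)) → MvPolynomial (Fin n) k) →ₗ[MvPolynomial (Fin n) k]
    (Fin (rank i) → MvPolynomial (Fin n) k)
  aug : (Fin (rank 0) → MvPolynomial (Fin n) k) →ₗ[MvPolynomial (Fin n) k]
    (MvPolynomial (Fin n) k ⧸ I)
  d_degree : ∀ i m, ∀ v ∈ freeDegree (deg (i + 1)) m, d i v ∈ freeDegree (k := k) (deg i) m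
  aug_degree : ∀ m, ∀ v ∈ freeDegree (deg 0) m, aug v ∈ quotientDegree I m
  aug_surjective : Function.Surjective aug
  exact_zero : Function.Exact (d 0) aug
  exact_succ : ∀ i, Function.Exact (d (i + 1)) (d i)

namespace GradedFreeResolution

variable {k : Type*} [Field k] {n : ℕ} {I : Ideal (MvPolynomial (Fin n) k)}

/-- The module `k ⊗ Fᵢ`, the tensor product being over `S`. -/
abbrev Tensor (F : GradedFreeResolution I) (i : ℕ) : Type _ :=
  ResidueModule k n ⊗[MvPolynomial (Fin n) k] (Fin (F.rank i) → MvPolynomial (Fin n) k)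

/-- The differential `k ⊗ Fᵢ₊₁ → k ⊗ Fᵢ`. -/
noncomputable def tensorD (F : GradedFreeResolution I) (i : ℕ) :
    F.Tensor (i + 1) →ₗ[MvPolynomial (Fin n) k] F.Tensor i :=
  (F.d i).lTensor (ResidueModule k n)

/-- The degree `j` part of `k ⊗ Fᵢ`: all `1 ⊗ v` with `v` in the degree `j` part of `Fᵢ`. -/
noncomputable def tensorDegree (F : GradedFreeResolution I) (i j : ℕ) :
    Submodule k (F.Tensor i) :=
  (freeDegree (F.deg i) j).map
    ((TensorProduct.mk (MvPolynomial (Fin n) k) (ResidueModule k n)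
      (Fin (F.rank i) → MvPolynomial (Fin n) k) (ResidueModule.one k n)).restrictScalars k)

/-- The cycles of `k ⊗ F` in homological degree `i` (everything for `i = 0`). -/
noncomputable def cycles (F : GradedFreeResolution I) :
    ∀ i, Submodule (MvPolynomial (Fin n) k) (F.Tensor i)
  | 0 => ⊤
  | i + 1 => LinearMap.ker (F.tensorD i)

/-- The boundaries of `k ⊗ F` in homological degree `i`. -/
noncomputable def boundaries (F : GradedFreeResolution I) (i : ℕ) :
    Submodule (MvPolynomial (Fin n) k) (F.Tensor i) :=
  LinearMap.range (F.tensorD i)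

/-- `Torᵢ(S ⧸ I, k)ⱼ`: the degree `j` part of the `i`-th homology of `k ⊗ F`, that is, the classes
modulo boundaries of the cycles lying in degree `j`. -/
noncomputable def torDegree (F : GradedFreeResolution I) (i j : ℕ) :
    Submodule k (F.Tensor i ⧸ (F.boundaries i).restrictScalars k) :=
  (F.tensorDegree i j ⊓ (F.cycles i).restrictScalars k).map
    ((F.boundaries i).restrictScalars k).mkQ

end GradedFreeResolution

/-! Existence of a graded free resolution for a homogeneous ideal. -/

section Existence

variable {k : Type*} [Field k] {n : ℕ}

/-- The component of degree `m` of a vector in `⨁ₑ S(-deg e)`. -/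
noncomputable def freeComponent {r : ℕ} (deg : Fin r → ℕ) (m : ℕ) :
    (Fin r → MvPolynomial (Fin n) k) →ₗ[k] (Fin r → MvPolynomial (Fin n) k) :=
  LinearMap.pi fun e =>
    if deg e ≤ m then (MvPolynomial.homogeneousComponent (m - deg e)).comp (LinearMap.proj e)
    else 0

theorem coeff_freeComponent {r : ℕ} (deg : Fin r → ℕ) (m : ℕ)
    (v : Fin r → MvPolynomial (Fin n) k) (e : Fin r) (s : Fin n →₀ ℕ) :
    (freeComponent deg m v e).coeff s =
      if s.degree + deg e = m then (v e).coeff s else 0 := by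
  unfold freeComponent
  rw [LinearMap.pi_apply]
  by_cases h : deg e ≤ m
  · rw [if_pos h, LinearMap.comp_apply, LinearMap.proj_apply,
      MvPolynomial.coeff_homogeneousComponent]
    have : s.degree = m - deg e ↔ s.degree + deg e = m := by omega
    simp only [this]
  · rw [if_neg h, if_neg (by omega)]
    simp

theorem freeComponent_mem {r : ℕ} (deg : Fin r → ℕ) (m : ℕ)
    (v : Fin r → MvPolynomial (Fin n) k) : freeComponent deg m v ∈ freeDegree deg m := by
  intro e s hs
  rw [MvPolynomial.mem_support_iff, coeff_freeComponent] at hs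
  by_contra h
  exact hs (if_neg h)

theorem freeComponent_of_mem {r : ℕ} (deg : Fin r → ℕ) (m m' : ℕ)
    (v : Fin r → MvPolynomial (Fin n) k) (hv : v ∈ freeDegree deg m) :
    freeComponent deg m' v = if m = m' then v else 0 := by
  funext e
  ext s
  rw [coeff_freeComponent]
  by_cases hs : s ∈ (v e).support
  · rw [hv e s hs]
    split_ifs <;> simp
  · rw [MvPolynomial.notMem_support_iff] at hs
    split_ifs <;> simp [hs]

theorem exists_sum_freeComponent {r : ℕ} (deg : Fin r → ℕ)
    (v : Fin r → MvPolynomial (Fin n) k) :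
    ∃ M, ∑ m ∈ Finset.range M, freeComponent deg m v = v := by
  classical
  refine ⟨(Finset.univ.sup fun e => (v e).support.sup fun s => s.degree + deg e) + 1, ?_⟩
  funext e
  ext s
  rw [Finset.sum_apply, MvPolynomial.coeff_sum]
  simp only [coeff_freeComponent]
  rw [Finset.sum_ite_eq]
  by_cases hs : s ∈ (v e).support
  · rw [if_pos]
    rw [Finset.mem_range, Nat.lt_succ_iff]
    exact (Finset.le_sup (f := fun s => s.degree + deg e) hs).trans
      (Finset.le_sup (f := fun e => (v e).support.sup fun s => s.degree + deg e)
        (Finset.mem_univ e))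
  · rw [MvPolynomial.notMem_support_iff] at hs
    split_ifs <;> simp [hs]

theorem freeComponent_map {r r' : ℕ} (deg : Fin r → ℕ) (deg' : Fin r' → ℕ)
    (φ : (Fin r' → MvPolynomial (Fin n) k) →ₗ[MvPolynomial (Fin n) k]
      (Fin r → MvPolynomial (Fin n) k))
    (hφ : ∀ m, ∀ v ∈ freeDegree deg' m, φ v ∈ freeDegree (k := k) deg m)
    (m : ℕ) (v : Fin r' → MvPolynomial (Fin n) k) :
    φ (freeComponent deg' m v) = freeComponent deg m (φ v) := by
  classical
  obtain ⟨M, hM⟩ := exists_sum_freeComponent deg' v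
  have hM' : v = ∑ m ∈ Finset.range (max M (m + 1)), freeComponent deg' m v := by
    conv_lhs => rw [← hM]
    refine Finset.sum_subset (Finset.range_mono (le_max_left _ _)) fun x _ hx => ?_
    have := congrArg (freeComponent deg' x) hM
    rw [map_sum, Finset.sum_eq_zero] at this
    · exact this.symm
    · intro y hy
      rw [freeComponent_of_mem deg' y x _ (freeComponent_mem _ _ _), if_neg]
      rintro rfl
      exact hx hy
  have h2 : freeComponent deg m (φ v) =
      ∑ x ∈ Finset.range (max M (m + 1)), freeComponent deg m (φ (freeComponent deg' x v)) := by
    conv_lhs => rw [hM', map_sum, map_sum]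
  rw [h2, Finset.sum_eq_single m]
  · rw [freeComponent_of_mem deg m m _ (hφ m _ (freeComponent_mem _ _ _)), if_pos rfl]
  · intro x _ hx
    rw [freeComponent_of_mem deg x m _ (hφ x _ (freeComponent_mem _ _ _)), if_neg hx]
  · intro h
    exact absurd (Finset.mem_range.2 (by omega)) h

theorem exists_graded_cover {r : ℕ} (deg : Fin r → ℕ)
    (N : Submodule (MvPolynomial (Fin n) k) (Fin r → MvPolynomial (Fin n) k))
    (hN : ∀ v ∈ N, ∀ m, freeComponent deg m v ∈ N) :
    ∃ (r' : ℕ) (deg' : Fin r' → ℕ)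
      (φ : (Fin r' → MvPolynomial (Fin n) k) →ₗ[MvPolynomial (Fin n) k]
        (Fin r → MvPolynomial (Fin n) k)),
      (∀ m, ∀ v ∈ freeDegree deg' m, φ v ∈ freeDegree (k := k) deg m) ∧
        LinearMap.range φ = N := by
  classical
  obtain ⟨G, hG⟩ := (IsNoetherian.noetherian N : N.FG)
  have hGN : ∀ v ∈ G, v ∈ N := fun v hv => hG ▸ Submodule.subset_span hv
  choose M hM using fun v => exists_sum_freeComponent (k := k) (n := n) deg v
  let H : Finset (Fin r → MvPolynomial (Fin n) k) :=
    G.biUnion fun v => (Finset.range (M v)).image fun m => freeComponent deg m v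
  have hH : ∀ w ∈ H, ∃ m, w ∈ freeDegree (k := k) deg m ∧ w ∈ N := by
    intro w hw
    obtain ⟨v, hv, hw⟩ := Finset.mem_biUnion.1 hw
    obtain ⟨m, _, rfl⟩ := Finset.mem_image.1 hw
    exact ⟨m, freeComponent_mem _ _ _, hN v (hGN v hv) m⟩
  choose D hD hDN using hH
  let q : Fin H.card → H := H.equivFin.symm
  refine ⟨H.card, fun e => D (q e) (q e).2,
    Fintype.linearCombination (MvPolynomial (Fin n) k) fun e => (q e : Fin r → _), ?_, ?_⟩
  · intro m v hv f s hs
    rw [Fintype.linearCombination_apply, Finset.sum_apply] at hs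
    obtain ⟨e, -, hs⟩ := Finset.mem_biUnion.1 (MvPolynomial.support_sum hs)
    rw [Pi.smul_apply, smul_eq_mul] at hs
    obtain ⟨s₁, h₁, s₂, h₂, rfl⟩ := Finset.mem_add.1 (MvPolynomial.support_mul _ _ hs)
    have e₁ := hv e s₁ h₁
    have e₂ := hD (q e) (q e).2 f s₂ h₂
    rw [map_add]
    dsimp only at e₁
    omega
  · rw [Fintype.range_linearCombination]
    apply le_antisymm
    · rw [Submodule.span_le]
      rintro _ ⟨e, rfl⟩
      exact hDN (q e) (q e).2
    · rw [← hG, Submodule.span_le]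
      intro v hv
      rw [← hM v]
      refine Submodule.sum_mem _ fun m hm => Submodule.subset_span ?_
      have hw : freeComponent deg m v ∈ H :=
        Finset.mem_biUnion.2 ⟨v, hv, Finset.mem_image.2 ⟨m, hm, rfl⟩⟩
      exact ⟨H.equivFin ⟨_, hw⟩, by simp [q]⟩

/-- A graded submodule of a graded free module, as a state of the recursive construction. -/
structure GradedKernel (k : Type*) [Field k] (n : ℕ) where
  rank : ℕ
  deg : Fin rank → ℕ
  N : Submodule (MvPolynomial (Fin n) k) (Fin rank → MvPolynomial (Fin n) k)
  graded : ∀ v ∈ N, ∀ m, freeComponent deg m v ∈ N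

namespace GradedKernel

noncomputable def nextRank (K : GradedKernel k n) : ℕ :=
  (exists_graded_cover K.deg K.N K.graded).choose

noncomputable def nextDeg (K : GradedKernel k n) : Fin K.nextRank → ℕ :=
  (exists_graded_cover K.deg K.N K.graded).choose_spec.choose

noncomputable def cover (K : GradedKernel k n) :
    (Fin K.nextRank → MvPolynomial (Fin n) k) →ₗ[MvPolynomial (Fin n) k]
      (Fin K.rank → MvPolynomial (Fin n) k) :=
  (exists_graded_cover K.deg K.N K.graded).choose_spec.choose_spec.choose

theorem cover_degree (K : GradedKernel k n) (m : ℕ) :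
    ∀ v ∈ freeDegree K.nextDeg m, K.cover v ∈ freeDegree (k := k) K.deg m :=
  (exists_graded_cover K.deg K.N K.graded).choose_spec.choose_spec.choose_spec.1 m

theorem range_cover (K : GradedKernel k n) : LinearMap.range K.cover = K.N :=
  (exists_graded_cover K.deg K.N K.graded).choose_spec.choose_spec.choose_spec.2

noncomputable def next (K : GradedKernel k n) : GradedKernel k n where
  rank := K.nextRank
  deg := K.nextDeg
  N := LinearMap.ker K.cover
  graded := by
    intro v hv m
    rw [LinearMap.mem_ker] at hv ⊢
    rw [freeComponent_map K.deg K.nextDeg K.cover K.cover_degree, hv, map_zero]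

noncomputable def iter (K : GradedKernel k n) : ℕ → GradedKernel k n
  | 0 => K
  | i + 1 => (K.iter i).next

end GradedKernel

theorem exists_gradedFreeResolution (I : Ideal (MvPolynomial (Fin n) k))
    (hI : ∀ p ∈ I, ∀ m, MvPolynomial.homogeneousComponent m p ∈ I) :
    Nonempty (GradedFreeResolution I) := by
  let π : (Fin 1 → MvPolynomial (Fin n) k) →ₗ[MvPolynomial (Fin n) k] MvPolynomial (Fin n) k :=
    LinearMap.proj 0
  let K : GradedKernel k n :=
    { rank := 1
      deg := fun _ => 0
      N := Submodule.comap π I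
      graded := by
        intro v hv m
        have := hI (v 0) hv m
        rw [Submodule.mem_comap]
        convert this using 1
        change freeComponent (fun _ => 0) m v 0 = _
        ext s
        rw [coeff_freeComponent, MvPolynomial.coeff_homogeneousComponent, add_zero] }
  refine ⟨{
    rank := fun i => (K.iter i).rank
    deg := fun i => (K.iter i).deg
    d := fun i => (K.iter i).cover
    aug := (Submodule.mkQ I).comp π
    d_degree := fun i m => (K.iter i).cover_degree m
    aug_degree := ?_
    aug_surjective := ?_
    exact_zero := ?_
    exact_succ := ?_ }⟩
  · intro m v hv
    refine ⟨π v, ?_, rfl⟩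
    intro s hs
    have h := hv (0 : Fin 1) s (MvPolynomial.mem_support_iff.2 hs)
    have h' : s.degree = m := h
    rw [← h', Finsupp.degree_eq_weight_one]
    rfl
  · intro y
    obtain ⟨p, rfl⟩ := Ideal.Quotient.mk_surjective y
    exact ⟨fun _ => p, rfl⟩
  · intro v
    refine Iff.trans ?_ (SetLike.ext_iff.1 K.range_cover v).symm
    exact Submodule.Quotient.mk_eq_zero I
  · intro i v
    exact (SetLike.ext_iff.1 (K.iter i).next.range_cover v).symm

end Existence

/-- The graded Betti number `β_{i,j} = dim_k Torᵢ(S ⧸ I, k)ⱼ` over `S = k[x₁, …, xₙ]`, for a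
homogeneous ideal `I`. -/
noncomputable def gradedBetti {k : Type*} [Field k] {n : ℕ} (I : Ideal (MvPolynomial (Fin n) k))
    (hI : ∀ p ∈ I, ∀ m, MvPolynomial.homogeneousComponent m p ∈ I) (i j : ℕ) : ℕ :=
  Module.finrank k ((exists_gradedFreeResolution I hI).some.torDegree i j)

/-- The index of the variable `x_c`, `1 ≤ c ≤ n`, among `x_1, …, x_n`. -/
def varIndex {n : ℕ} (c : ℕ) (h₁ : 1 ≤ c) (h₂ : c ≤ n) : Fin n := ⟨c - 1, by omega⟩

/-- The exponents of the squarefree quadratic monomials in the variables `x_i`, `i ≤ b`, that are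
lexicographically larger than or equal to `x_a x_b`, where `x_i > x_j` for `i < j`. -/
def lexSegment {n : ℕ} (a b : Fin n) : Set (Fin n →₀ ℕ) :=
  {s | s.degree = 2 ∧ (∀ i, s i ≤ 1) ∧ (∀ i ∈ s.support, i ≤ b) ∧
    toLex (Finsupp.single a 1 + Finsupp.single b 1) ≤ toLex s}

/-- The ideal `L(a,b)`. -/
noncomputable def lexIdeal (k : Type*) [Field k] {n : ℕ} (a b : Fin n) :
    Ideal (MvPolynomial (Fin n) k) :=
  Ideal.span ((fun s => MvPolynomial.monomial s 1) '' lexSegment a b)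

theorem lexIdeal_homogeneous (k : Type*) [Field k] {n : ℕ} (a b : Fin n) :
    ∀ p ∈ lexIdeal k a b, ∀ m, MvPolynomial.homogeneousComponent m p ∈ lexIdeal k a b := by
  intro p hp m
  rw [lexIdeal, MvPolynomial.mem_ideal_span_monomial_image] at hp ⊢
  intro s hs
  rw [MvPolynomial.support_homogeneousComponent, Finset.mem_filter] at hs
  exact hp s hs.1

/-! ### Homogeneous elements and lifts for graded free modules. -/

section GradedLifts

variable {k : Type*} [Field k] {n : ℕ}

/-! The ideal has linear quotients. Its generators are the products x_i x_l with i < l, i ≤ a, l ≤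
b. Add them one at a time in decreasing lex order. When x_P x_J is added to the ideal of its
predecessors, the colon ideal is generated by the variables x_l with l < J, l ≠ P
(`initialSegment_colon`). Such an ideal is resolved by a Koszul-type complex whose ranks are
binomial coefficients (`hasLinearResolution_variables`).

If J = I : p, the mapping cone of multiplication by p resolves S/(I + (p)) (`exists_cone`). In the
present case the cone stays linear, and its ranks are the sums of the ranks of the two resolutions,
one of them shifted by one homological degree. Counting variables from 0, the pair (P, J)
contributes C(J-1, i) in homological degree i+1. Summing over P < J < b and then over P < a gives
a·C(b-1, i+1) - C(a, i+2), which Pascal's rule turns into the stated formula.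

Since `gradedBetti` is computed from an arbitrarily chosen resolution, that resolution has to be
compared with the linear one. The linear one is minimal for degree reasons, and the usual comparison
by chain maps and homotopies, reduced modulo the maximal ideal, identifies Tor with the span of its
basis (`finrank_torDegree_eq_card`). -/

theorem smul_mem_freeDegree {r : ℕ} {deg : Fin r → ℕ} {a m : ℕ} {p : MvPolynomial (Fin n) k}
    {v : Fin r → MvPolynomial (Fin n) k} (hp : ∀ s ∈ p.support, s.degree + a = m)
    (hv : v ∈ freeDegree (k := k) deg a) : p • v ∈ freeDegree (k := k) deg m := by
  classical
  intro e s hs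
  rw [Pi.smul_apply, smul_eq_mul] at hs
  obtain ⟨s₁, h₁, s₂, h₂, rfl⟩ := Finset.mem_add.1 (MvPolynomial.support_mul _ _ hs)
  have e₁ := hp s₁ h₁
  have e₂ := hv e s₂ h₂
  rw [map_add]
  omega

theorem single_mem_freeDegree {r : ℕ} (deg : Fin r → ℕ) (e : Fin r) :
    (Pi.single e 1 : Fin r → MvPolynomial (Fin n) k) ∈ freeDegree (k := k) deg (deg e) := by
  classical
  intro f s hs
  rcases eq_or_ne f e with rfl | h
  · rw [Pi.single_eq_same, MvPolynomial.mem_support_iff, MvPolynomial.coeff_one] at hs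
    have : s = 0 := by by_contra h; exact hs (if_neg (Ne.symm h))
    simp [this]
  · simp [Pi.single_eq_of_ne h] at hs

theorem map_eq_sum_smul_single {r : ℕ} {B : Type*} [AddCommGroup B]
    [Module (MvPolynomial (Fin n) k) B]
    (φ : (Fin r → MvPolynomial (Fin n) k) →ₗ[MvPolynomial (Fin n) k] B)
    (v : Fin r → MvPolynomial (Fin n) k) : φ v = ∑ e, v e • φ (Pi.single e 1) := by
  conv_lhs => rw [pi_eq_sum_univ' v]
  simp

theorem map_mem_freeDegree_of_single {r r' : ℕ} {deg : Fin r → ℕ} {deg' : Fin r' → ℕ}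
    {φ : (Fin r → MvPolynomial (Fin n) k) →ₗ[MvPolynomial (Fin n) k]
      (Fin r' → MvPolynomial (Fin n) k)}
    (hφ : ∀ e, φ (Pi.single e 1) ∈ freeDegree (k := k) deg' (deg e)) (m : ℕ)
    (v : Fin r → MvPolynomial (Fin n) k) (hv : v ∈ freeDegree (k := k) deg m) :
    φ v ∈ freeDegree (k := k) deg' m := by
  rw [map_eq_sum_smul_single φ v]
  exact Submodule.sum_mem _ fun e _ => smul_mem_freeDegree (hv e) (hφ e)

/-- Projectivity of a free module: lifts may be chosen on the basis. The predicate `P` carries a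
degree condition for chain maps and is trivial for homotopies. -/
theorem exists_lift_of_single {r : ℕ} {A B : Type*} [AddCommGroup A] [AddCommGroup B]
    [Module (MvPolynomial (Fin n) k) A] [Module (MvPolynomial (Fin n) k) B]
    (φ : (Fin r → MvPolynomial (Fin n) k) →ₗ[MvPolynomial (Fin n) k] B)
    (ψ : A →ₗ[MvPolynomial (Fin n) k] B) (P : Fin r → A → Prop)
    (h : ∀ e, ∃ v, P e v ∧ ψ v = φ (Pi.single e 1)) :
    ∃ θ : (Fin r → MvPolynomial (Fin n) k) →ₗ[MvPolynomial (Fin n) k] A,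
      (∀ e, P e (θ (Pi.single e 1))) ∧ ∀ v, ψ (θ v) = φ v := by
  choose w hw hw' using h
  refine ⟨Fintype.linearCombination _ w, fun e => ?_, fun v => ?_⟩
  · rw [Fintype.linearCombination_apply_single, one_smul]
    exact hw e
  · rw [Fintype.linearCombination_apply, map_eq_sum_smul_single φ v, map_sum]
    simp [hw']

/-- The vector of constant coefficients. -/
noncomputable def constVec {r : ℕ} : (Fin r → MvPolynomial (Fin n) k) →ₗ[k] (Fin r → k) where
  toFun v e := MvPolynomial.constantCoeff (v e)
  map_add' v w := by ext e; simp
  map_smul' c v := by ext e; simp [MvPolynomial.smul_eq_C_mul]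

theorem constVec_apply {r : ℕ} (v : Fin r → MvPolynomial (Fin n) k) (e : Fin r) :
    constVec v e = MvPolynomial.constantCoeff (v e) := rfl

/-- The kernel of `constVec` is 𝔪F, with 𝔪 the ideal of the variables, and linear maps carry 𝔪F into
𝔪F'. -/
theorem constVec_map_eq_zero {r r' : ℕ}
    (φ : (Fin r → MvPolynomial (Fin n) k) →ₗ[MvPolynomial (Fin n) k]
      (Fin r' → MvPolynomial (Fin n) k))
    {v : Fin r → MvPolynomial (Fin n) k} (hv : constVec v = 0) : constVec (φ v) = 0 := by
  ext f
  rw [map_eq_sum_smul_single φ v, constVec_apply, Finset.sum_apply, map_sum]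
  refine Finset.sum_eq_zero fun e _ => ?_
  rw [Pi.smul_apply, smul_eq_mul, map_mul, ← constVec_apply v e, hv, Pi.zero_apply, zero_mul]

theorem constVec_apply_eq_zero {r : ℕ} {deg : Fin r → ℕ} {m : ℕ}
    {v : Fin r → MvPolynomial (Fin n) k} (hv : v ∈ freeDegree (k := k) deg m) {e : Fin r}
    (he : deg e ≠ m) : constVec v e = 0 := by
  by_contra h
  exact he (by simpa using hv e 0 (MvPolynomial.mem_support_iff.2 h))

theorem exists_mem_freeDegree_of_mem_range {r r' : ℕ} {deg : Fin r → ℕ} {deg' : Fin r' → ℕ}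
    {φ : (Fin r → MvPolynomial (Fin n) k) →ₗ[MvPolynomial (Fin n) k]
      (Fin r' → MvPolynomial (Fin n) k)}
    (hφ : ∀ m, ∀ v ∈ freeDegree deg m, φ v ∈ freeDegree (k := k) deg' m) {m : ℕ}
    {w : Fin r' → MvPolynomial (Fin n) k} (hw : w ∈ freeDegree (k := k) deg' m)
    (h : ∃ v, φ v = w) : ∃ v, v ∈ freeDegree (k := k) deg m ∧ φ v = w := by
  obtain ⟨v, rfl⟩ := h
  refine ⟨freeComponent deg m v, freeComponent_mem _ _ _, ?_⟩
  rw [freeComponent_map deg' deg φ hφ, freeComponent_of_mem deg' m m _ hw, if_pos rfl]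

end GradedLifts

/-! ### Comparison of resolutions and independence of Tor. -/

namespace GradedFreeResolution

variable {k : Type*} [Field k] {n : ℕ} {I J : Ideal (MvPolynomial (Fin n) k)}

theorem d_d (F : GradedFreeResolution I) (i : ℕ)
    (v : Fin (F.rank (i + 2)) → MvPolynomial (Fin n) k) : F.d i (F.d (i + 1) v) = 0 :=
  (F.exact_succ i _).2 ⟨v, rfl⟩

theorem aug_d (F : GradedFreeResolution I) (v : Fin (F.rank 1) → MvPolynomial (Fin n) k) :
    F.aug (F.d 0 v) = 0 :=
  (F.exact_zero _).2 ⟨v, rfl⟩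

/-- Any preimage can be replaced by its component of degree m. Since the degrees in S/I are known
only through representatives, the components of the preimage are mapped to homogeneous polynomials
and compared with p modulo I, using that I is homogeneous. -/
theorem exists_aug_eq (F : GradedFreeResolution I)
    (hI : ∀ p ∈ I, ∀ m, MvPolynomial.homogeneousComponent m p ∈ I) {m : ℕ}
    {p : MvPolynomial (Fin n) k} (hp : p.IsHomogeneous m) :
    ∃ v, v ∈ freeDegree (k := k) (F.deg 0) m ∧ F.aug v = Ideal.Quotient.mk I p := by
  obtain ⟨v, hv⟩ := F.aug_surjective (Ideal.Quotient.mk I p)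
  refine ⟨freeComponent (F.deg 0) m v, freeComponent_mem _ _ _, ?_⟩
  choose q hq hq' using fun l =>
    F.aug_degree l (freeComponent (F.deg 0) l v) (freeComponent_mem _ _ _)
  replace hq' : ∀ l, Ideal.Quotient.mk I (q l) = F.aug (freeComponent (F.deg 0) l v) := hq'
  obtain ⟨M, hM⟩ := exists_sum_freeComponent (F.deg 0) v
  have h1 : ∑ l ∈ Finset.range M, q l - p ∈ I := by
    rw [← Ideal.Quotient.eq, ← hv, map_sum]
    conv_rhs => rw [← hM, map_sum]
    exact Finset.sum_congr rfl fun l _ => hq' l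
  have h2 := hI _ h1 m
  rw [map_sub, map_sum, MvPolynomial.homogeneousComponent_of_mem hp, if_pos rfl] at h2
  simp only [MvPolynomial.homogeneousComponent_of_mem (hq _)] at h2
  rw [Finset.sum_ite_eq] at h2
  split_ifs at h2 with hm
  · rw [← hq']
    exact Ideal.Quotient.eq.2 h2
  -- Here m lies beyond all components of v, so the component chosen is zero, and `h2` says that p
  -- itself lies in I.
  · have h3 : freeComponent (F.deg 0) m v = 0 := by
      conv_lhs => rw [← hM, map_sum]
      refine Finset.sum_eq_zero fun l hl => ?_
      rw [freeComponent_of_mem _ l m _ (freeComponent_mem _ _ _), if_neg]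
      rintro rfl
      exact hm hl
    rw [h3, map_zero, eq_comm, Ideal.Quotient.eq_zero_iff_mem]
    simpa using I.neg_mem h2

/-- Multiplication by a homogeneous `p` with `p J ⊆ I` lifts to a homogeneous chain map. -/
theorem exists_chainMap (F : GradedFreeResolution J) (G : GradedFreeResolution I)
    (hI : ∀ p ∈ I, ∀ m, MvPolynomial.homogeneousComponent m p ∈ I) {D : ℕ}
    {p : MvPolynomial (Fin n) k} (hp : p.IsHomogeneous D) (hpJ : ∀ q ∈ J, p * q ∈ I) :
    ∃ φ : ∀ i, (Fin (F.rank i) → MvPolynomial (Fin n) k) →ₗ[MvPolynomial (Fin n) k]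
        (Fin (G.rank i) → MvPolynomial (Fin n) k),
      (∀ i m, ∀ v ∈ freeDegree (k := k) (fun e => F.deg i e + D) m,
        φ i v ∈ freeDegree (k := k) (G.deg i) m) ∧
      (∀ i v, G.d i (φ (i + 1) v) = φ i (F.d i v)) ∧
      (∀ v q, F.aug v = Ideal.Quotient.mk J q →
        G.aug (φ 0 v) = Ideal.Quotient.mk I (p * q)) := by
  -- Besides homogeneity, the subtype records that φ ∘ d lands in the image of `G.d i`. This is what
  -- the next lift needs, so the recursion can run on single maps.
  let X : ℕ → Type _ := fun i =>
    {φ : (Fin (F.rank i) → MvPolynomial (Fin n) k) →ₗ[MvPolynomial (Fin n) k]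
        (Fin (G.rank i) → MvPolynomial (Fin n) k) //
      (∀ m, ∀ v ∈ freeDegree (k := k) (fun e => F.deg i e + D) m,
        φ v ∈ freeDegree (k := k) (G.deg i) m) ∧ ∀ v, ∃ w, G.d i w = φ (F.d i v)}
  let μ : (MvPolynomial (Fin n) k ⧸ J) →ₗ[MvPolynomial (Fin n) k] (MvPolynomial (Fin n) k ⧸ I) :=
    Submodule.mapQ J I (LinearMap.lsmul _ _ p) fun q hq => hpJ q hq
  have hμ : ∀ q, μ (Ideal.Quotient.mk J q) = Ideal.Quotient.mk I (p * q) := fun q => rfl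
  have base : ∃ x : X 0, ∀ v, G.aug (x.1 v) = μ (F.aug v) := by
    obtain ⟨φ, h1, h2⟩ := exists_lift_of_single (μ.comp F.aug) G.aug
      (fun e v => v ∈ freeDegree (k := k) (G.deg 0) (F.deg 0 e + D)) (fun e => by
        obtain ⟨q, hq, hq'⟩ := F.aug_degree _ _ (single_mem_freeDegree (F.deg 0) e)
        replace hq' : Ideal.Quotient.mk J q = F.aug (Pi.single e 1) := hq'
        rw [LinearMap.comp_apply, ← hq', hμ]
        refine G.exists_aug_eq hI ?_
        rw [add_comm]
        exact hp.mul hq)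
    refine ⟨⟨φ, map_mem_freeDegree_of_single h1, fun v => ?_⟩, h2⟩
    exact (G.exact_zero _).1 (by rw [h2, LinearMap.comp_apply, F.aug_d, map_zero])
  have step : ∀ i (x : X i), ∃ y : X (i + 1), ∀ v, G.d i (y.1 v) = x.1 (F.d i v) := by
    rintro i ⟨φ, hφ, hφ'⟩
    obtain ⟨ψ, h1, h2⟩ := exists_lift_of_single (φ.comp (F.d i)) (G.d i)
      (fun e v => v ∈ freeDegree (k := k) (G.deg (i + 1)) (F.deg (i + 1) e + D)) (fun e => by
        refine exists_mem_freeDegree_of_mem_range (G.d_degree i) ?_ (hφ' _)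
        refine hφ _ _ fun f s hs => ?_
        have := F.d_degree i _ _ (single_mem_freeDegree _ e) f s hs
        dsimp only
        omega)
    refine ⟨⟨ψ, map_mem_freeDegree_of_single h1, fun v => ?_⟩, h2⟩
    exact (G.exact_succ i _).1 (by rw [h2, LinearMap.comp_apply, F.d_d, map_zero])
  obtain ⟨x₀, hx₀⟩ := base
  choose next hnext using step
  let x : ∀ i, X i := fun i => Nat.rec x₀ (fun i y => next i y) i
  refine ⟨fun i => (x i).1, fun i => (x i).2.1, fun i => hnext i (x i), fun v q hq => ?_⟩
  rw [← hμ, ← hq]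
  exact hx₀ v

/-- A chain map over the identity agrees with the identity modulo boundaries and the maximal ideal
on everything that is a cycle modulo the maximal ideal. -/
theorem exists_homotopy (F : GradedFreeResolution I)
    (h : ∀ i, (Fin (F.rank i) → MvPolynomial (Fin n) k) →ₗ[MvPolynomial (Fin n) k]
        (Fin (F.rank i) → MvPolynomial (Fin n) k))
    (h₀ : ∀ v, F.aug (h 0 v) = F.aug v) (h₁ : ∀ i v, F.d i (h (i + 1) v) = h i (F.d i v)) :
    (∃ s : (Fin (F.rank 0) → MvPolynomial (Fin n) k) →ₗ[MvPolynomial (Fin n) k]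
        (Fin (F.rank 1) → MvPolynomial (Fin n) k), ∀ v, F.d 0 (s v) = h 0 v - v) ∧
    ∀ i, ∃ (s : (Fin (F.rank (i + 1)) → MvPolynomial (Fin n) k) →ₗ[MvPolynomial (Fin n) k]
        (Fin (F.rank (i + 2)) → MvPolynomial (Fin n) k))
      (t : (Fin (F.rank i) → MvPolynomial (Fin n) k) →ₗ[MvPolynomial (Fin n) k]
        (Fin (F.rank (i + 1)) → MvPolynomial (Fin n) k)),
      ∀ v, F.d (i + 1) (s v) = h (i + 1) v - v - t (F.d i v) := by
  have base : ∃ s : (Fin (F.rank 0) → MvPolynomial (Fin n) k) →ₗ[MvPolynomial (Fin n) k]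
        (Fin (F.rank 1) → MvPolynomial (Fin n) k), ∀ v, F.d 0 (s v) = h 0 v - v := by
    obtain ⟨s, -, hs⟩ := exists_lift_of_single (h 0 - LinearMap.id) (F.d 0) (fun _ _ => True)
      (fun e => by
        simp only [true_and]
        exact (F.exact_zero _).1 (by simp [h₀]))
    exact ⟨s, hs⟩
  -- The condition on t is required only on boundaries: the later homotopies satisfy it up to a term
  -- that factors through d and dies because d ∘ d = 0.
  have step : ∀ i (t : (Fin (F.rank i) → MvPolynomial (Fin n) k) →ₗ[MvPolynomial (Fin n) k]
        (Fin (F.rank (i + 1)) → MvPolynomial (Fin n) k)),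
      (∀ v, F.d i (t (F.d i v)) = h i (F.d i v) - F.d i v) →
      ∃ s : (Fin (F.rank (i + 1)) → MvPolynomial (Fin n) k) →ₗ[MvPolynomial (Fin n) k]
        (Fin (F.rank (i + 2)) → MvPolynomial (Fin n) k),
      ∀ v, F.d (i + 1) (s v) = h (i + 1) v - v - t (F.d i v) := by
    intro i t ht
    obtain ⟨s, -, hs⟩ := exists_lift_of_single (h (i + 1) - LinearMap.id - t.comp (F.d i))
      (F.d (i + 1)) (fun _ _ => True) (fun e => by
        simp only [true_and]
        exact (F.exact_succ i _).1 (by simp [h₁, ht]))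
    exact ⟨s, hs⟩
  refine ⟨base, fun i => ?_⟩
  induction i with
  | zero =>
    obtain ⟨t, ht⟩ := base
    obtain ⟨s, hs⟩ := step 0 t fun v => ht _
    exact ⟨s, t, hs⟩
  | succ i ih =>
    obtain ⟨t, t', ht⟩ := ih
    obtain ⟨s, hs⟩ := step (i + 1) t fun v => by rw [ht, F.d_d, map_zero, sub_zero]
    exact ⟨s, t, hs⟩

/-- Under k ⊗ S^r ≅ k^r, the element 1 ⊗ v corresponds to the constant coefficients of v. Together
with `exists_one_tmul`, this turns statements about k ⊗ F into statements modulo 𝔪F. -/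
theorem one_tmul_eq_zero_iff (F : GradedFreeResolution I) (i : ℕ)
    (v : Fin (F.rank i) → MvPolynomial (Fin n) k) :
    (ResidueModule.one k n ⊗ₜ[MvPolynomial (Fin n) k] v : F.Tensor i) = 0 ↔ constVec v = 0 := by
  rw [← (TensorProduct.piScalarRight (MvPolynomial (Fin n) k) (MvPolynomial (Fin n) k)
    (ResidueModule k n) (Fin (F.rank i))).map_eq_zero_iff, TensorProduct.piScalarRight_apply,
    TensorProduct.piScalarRightHom_tmul, funext_iff, funext_iff]
  refine forall_congr' fun e => ?_
  rw [ResidueModule.smul_def]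
  change MvPolynomial.constantCoeff (v e) * (1 : k) = 0 ↔ _
  rw [mul_one]
  rfl

theorem exists_one_tmul (F : GradedFreeResolution I) (i : ℕ) (z : F.Tensor i) :
    ∃ v, (ResidueModule.one k n ⊗ₜ[MvPolynomial (Fin n) k] v : F.Tensor i) = z := by
  induction z using TensorProduct.induction_on with
  | zero => exact ⟨0, TensorProduct.tmul_zero _ _⟩
  | tmul c v =>
    refine ⟨(MvPolynomial.C (show k from c) : MvPolynomial (Fin n) k) • v, ?_⟩
    rw [TensorProduct.tmul_smul, TensorProduct.smul_tmul', ResidueModule.smul_def,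
      MvPolynomial.constantCoeff_C]
    congr 1
    exact mul_one (show k from c)
  | add x y hx hy =>
    obtain ⟨v, rfl⟩ := hx
    obtain ⟨w, rfl⟩ := hy
    exact ⟨v + w, TensorProduct.tmul_add _ _ _⟩

theorem one_tmul_mem_boundaries_iff (F : GradedFreeResolution I) (i : ℕ)
    (v : Fin (F.rank i) → MvPolynomial (Fin n) k) :
    (ResidueModule.one k n ⊗ₜ[MvPolynomial (Fin n) k] v : F.Tensor i) ∈ F.boundaries i ↔
      ∃ w, constVec (v - F.d i w) = 0 := by
  constructor
  · rintro ⟨z, hz⟩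
    obtain ⟨w, rfl⟩ := F.exists_one_tmul (i + 1) z
    refine ⟨w, ?_⟩
    rw [← F.one_tmul_eq_zero_iff, TensorProduct.tmul_sub, ← hz]
    exact sub_self _
  · rintro ⟨w, hw⟩
    refine ⟨ResidueModule.one k n ⊗ₜ w, ?_⟩
    rw [← F.one_tmul_eq_zero_iff, TensorProduct.tmul_sub, sub_eq_zero] at hw
    exact hw.symm

theorem one_tmul_mem_cycles_succ_iff (F : GradedFreeResolution I) (i : ℕ)
    (v : Fin (F.rank (i + 1)) → MvPolynomial (Fin n) k) :
    (ResidueModule.one k n ⊗ₜ[MvPolynomial (Fin n) k] v : F.Tensor (i + 1)) ∈ F.cycles (i + 1) ↔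
      constVec (F.d i v) = 0 := by
  rw [← F.one_tmul_eq_zero_iff]
  rfl

/-- The constant vectors supported on the basis elements of degree `j`. -/
noncomputable def constIncl {r : ℕ} (deg : Fin r → ℕ) (j : ℕ) :
    ({e : Fin r // deg e = j} → k) →ₗ[k] (Fin r → MvPolynomial (Fin n) k) where
  toFun w e := if h : deg e = j then MvPolynomial.C (w ⟨e, h⟩) else 0
  map_add' v w := by ext1 e; by_cases h : deg e = j <;> simp [h]
  map_smul' c v := by ext1 e; by_cases h : deg e = j <;> simp [h, MvPolynomial.smul_eq_C_mul]

theorem constVec_constIncl {r : ℕ} (deg : Fin r → ℕ) (j : ℕ) (w : {e : Fin r // deg e = j} → k)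
    (e : Fin r) : constVec (constIncl (n := n) deg j w) e = if h : deg e = j then w ⟨e, h⟩ else 0 := by
  rw [constVec_apply]
  change MvPolynomial.constantCoeff (if h : deg e = j then MvPolynomial.C (w ⟨e, h⟩) else 0) = _
  split_ifs <;> simp

theorem constIncl_mem {r : ℕ} (deg : Fin r → ℕ) (j : ℕ) (w : {e : Fin r // deg e = j} → k) :
    constIncl (n := n) deg j w ∈ freeDegree (k := k) deg j := by
  classical
  intro e s hs
  change s ∈ MvPolynomial.support (if h : deg e = j then MvPolynomial.C (w ⟨e, h⟩) else 0) at hs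
  split_ifs at hs with h
  · rw [MvPolynomial.mem_support_iff, MvPolynomial.coeff_C] at hs
    have : s = 0 := by by_contra h; exact hs (if_neg (Ne.symm h))
    simp [this, h]
  · simp at hs

/-- The graded Betti numbers can be read off any minimal graded free resolution. -/
theorem finrank_torDegree_eq_card (F G : GradedFreeResolution I)
    (hI : ∀ p ∈ I, ∀ m, MvPolynomial.homogeneousComponent m p ∈ I)
    (hG : ∀ i v, constVec (G.d i v) = 0) (i j : ℕ) :
    Module.finrank k (F.torDegree i j) = Fintype.card {e // G.deg i e = j} := by
  classical
  have h1 : ∀ q ∈ I, (1 : MvPolynomial (Fin n) k) * q ∈ I := fun q hq => by rwa [one_mul]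
  obtain ⟨f, hf, hfd, hf0⟩ := F.exists_chainMap G hI (MvPolynomial.isHomogeneous_one _ _) h1
  obtain ⟨g, hg, hgd, hg0⟩ := G.exists_chainMap F hI (MvPolynomial.isHomogeneous_one _ _) h1
  simp only [add_zero, one_mul] at hf hg hf0 hg0
  replace hf0 : ∀ v, G.aug (f 0 v) = F.aug v := fun v => by
    obtain ⟨q, hq⟩ := Ideal.Quotient.mk_surjective (F.aug v)
    rw [← hq, hf0 v q hq.symm]
  replace hg0 : ∀ v, F.aug (g 0 v) = G.aug v := fun v => by
    obtain ⟨q, hq⟩ := Ideal.Quotient.mk_surjective (G.aug v)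
    rw [← hq, hg0 v q hq.symm]
  -- F need not be minimal, so the homotopy term t ∘ d vanishes modulo 𝔪 only on cycles of k ⊗ F,
  -- and a boundary term remains.
  have hF : ∃ s : (Fin (F.rank i) → MvPolynomial (Fin n) k) →ₗ[MvPolynomial (Fin n) k]
      (Fin (F.rank (i + 1)) → MvPolynomial (Fin n) k),
      ∀ v, ResidueModule.one k n ⊗ₜ v ∈ F.cycles i →
        constVec (g i (f i v) - v - F.d i (s v)) = 0 := by
    obtain ⟨H0, H1⟩ := F.exists_homotopy (fun i => (g i).comp (f i))
      (fun v => by simp [hg0, hf0]) (fun i v => by simp [hgd, hfd])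
    cases i with
    | zero =>
      obtain ⟨s, hs⟩ := H0
      exact ⟨s, fun v _ => by simp [hs]⟩
    | succ i =>
      obtain ⟨s, t, hs⟩ := H1 i
      refine ⟨s, fun v hv => ?_⟩
      rw [one_tmul_mem_cycles_succ_iff] at hv
      simpa [hs] using constVec_map_eq_zero t hv
  -- Minimality of G kills both homotopy terms, so f ∘ g is the identity modulo 𝔪.
  have hGc : ∀ v, constVec (f i (g i v)) = constVec v := by
    obtain ⟨H0, H1⟩ := G.exists_homotopy (fun i => (f i).comp (g i))
      (fun v => by simp [hg0, hf0]) (fun i v => by simp [hgd, hfd])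
    intro v
    cases i with
    | zero =>
      obtain ⟨s, hs⟩ := H0
      have := hG 0 (s v)
      rwa [hs, map_sub, sub_eq_zero] at this
    | succ i =>
      obtain ⟨s, t, hs⟩ := H1 i
      have := hG (i + 1) (s v)
      rwa [hs, map_sub, map_sub, constVec_map_eq_zero t (hG i v), sub_zero, sub_eq_zero] at this
  have hcyc : ∀ v, (ResidueModule.one k n ⊗ₜ g i v : F.Tensor i) ∈ F.cycles i := by
    intro v
    cases i with
    | zero => trivial
    | succ i =>
      rw [one_tmul_mem_cycles_succ_iff, hgd]
      exact constVec_map_eq_zero (g i) (hG i v)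
  -- Ψ sends the basis elements of G of degree j to their classes under g. It is injective because f
  -- ∘ g ≡ 1 and f sends boundaries into 𝔪G; it fills `torDegree` because g ∘ f ≡ 1 on cycles modulo
  -- boundaries.
  let Ψ : ({e // G.deg i e = j} → k) →ₗ[k] (F.Tensor i ⧸ (F.boundaries i).restrictScalars k) :=
    ((F.boundaries i).restrictScalars k).mkQ ∘ₗ
      ((TensorProduct.mk (MvPolynomial (Fin n) k) (ResidueModule k n)
      (Fin (F.rank i) → MvPolynomial (Fin n) k) (ResidueModule.one k n)).restrictScalars k) ∘ₗ
      (g i).restrictScalars k ∘ₗ constIncl (G.deg i) j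
  have hΨ : ∀ w, Ψ w = ((F.boundaries i).restrictScalars k).mkQ
      (ResidueModule.one k n ⊗ₜ g i (constIncl (G.deg i) j w)) := fun w => rfl
  have hinj : Function.Injective Ψ := by
    rw [← LinearMap.ker_eq_bot, LinearMap.ker_eq_bot']
    intro w hw
    rw [hΨ, Submodule.mkQ_apply, Submodule.Quotient.mk_eq_zero,
      Submodule.restrictScalars_mem, one_tmul_mem_boundaries_iff] at hw
    obtain ⟨y, hy⟩ := hw
    have h2 := constVec_map_eq_zero (f i) hy
    rw [map_sub, map_sub, hGc, ← hfd, hG, sub_zero] at h2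
    ext ⟨e, he⟩
    have h3 := congrFun h2 e
    rwa [constVec_constIncl, dif_pos he] at h3
  have hrange : LinearMap.range Ψ = F.torDegree i j := by
    apply le_antisymm
    · rintro _ ⟨w, rfl⟩
      refine ⟨_, ⟨⟨g i (constIncl (G.deg i) j w), ?_, rfl⟩, hcyc _⟩, rfl⟩
      exact hg i j _ (constIncl_mem _ _ _)
    · rintro _ ⟨_, ⟨⟨v, hv, rfl⟩, hc⟩, rfl⟩
      refine ⟨fun e => constVec (f i v) e.1, ?_⟩
      rw [hΨ, Submodule.mkQ_apply, Submodule.mkQ_apply, Submodule.Quotient.eq,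
        Submodule.restrictScalars_mem]
      obtain ⟨s, hs⟩ := hF
      -- f v is homogeneous of degree j, so its constant coefficients sit only at basis elements of
      -- degree j.
      have h2 : constVec (constIncl (G.deg i) j (fun e => constVec (f i v) e.1) - f i v) = 0 := by
        ext e
        rw [map_sub, Pi.sub_apply, constVec_constIncl]
        split_ifs with he
        · exact sub_self _
        · rw [constVec_apply_eq_zero (hf i j v hv) he, sub_zero, Pi.zero_apply]
      have h3 := constVec_map_eq_zero (g i) h2
      have h4 := hs v hc
      change ResidueModule.one k n ⊗ₜ _ - ResidueModule.one k n ⊗ₜ v ∈ _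
      rw [← TensorProduct.tmul_sub, one_tmul_mem_boundaries_iff]
      refine ⟨s v, ?_⟩
      rw [map_sub] at h3
      have h5 := congrArg₂ (· + ·) h3 h4
      rw [← map_add, add_zero] at h5
      rw [← h5]
      congr 1
      abel
  rw [← hrange, LinearMap.finrank_range_of_inj hinj, Module.finrank_fintype_fun_eq_card]

end GradedFreeResolution

/-! ### Mapping cones and linear resolutions. -/

namespace GradedFreeResolution

variable {k : Type*} [Field k] {n : ℕ} {I J : Ideal (MvPolynomial (Fin n) k)}

/-- A vector of length `r + s` as a pair of vectors. -/
noncomputable def splitVec (k : Type*) [Field k] (n r s : ℕ) :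
    (Fin (r + s) → MvPolynomial (Fin n) k) ≃ₗ[MvPolynomial (Fin n) k]
      (Fin r → MvPolynomial (Fin n) k) × (Fin s → MvPolynomial (Fin n) k) :=
  (LinearEquiv.funCongrLeft (MvPolynomial (Fin n) k) (MvPolynomial (Fin n) k)
    finSumFinEquiv).trans (LinearEquiv.sumArrowLequivProdArrow _ _ _ _)

theorem splitVec_mem_freeDegree {r s : ℕ} {a : Fin r → ℕ} {b : Fin s → ℕ} {m : ℕ}
    {v : Fin (r + s) → MvPolynomial (Fin n) k} :
    v ∈ freeDegree (k := k) (Fin.append a b) m ↔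
      (splitVec k n r s v).1 ∈ freeDegree (k := k) a m ∧
        (splitVec k n r s v).2 ∈ freeDegree (k := k) b m := by
  constructor
  · intro h
    constructor
    · intro e t ht
      have := h (Fin.castAdd s e) t ht
      rwa [Fin.append_left] at this
    · intro e t ht
      have := h (Fin.natAdd r e) t ht
      rwa [Fin.append_right] at this
  · rintro ⟨h₁, h₂⟩ e
    induction e using Fin.addCases with
    | left e =>
      intro t ht
      rw [Fin.append_left]
      exact h₁ e t ht
    | right e =>
      intro t ht
      rw [Fin.append_right]
      exact h₂ e t ht

/-- The ranks of a mapping cone. -/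
def coneRank (r s : ℕ → ℕ) : ℕ → ℕ
  | 0 => r 0
  | i + 1 => r (i + 1) + s i

/-- The degrees of the basis elements of a mapping cone. -/
def coneDeg (F : GradedFreeResolution J) (G : GradedFreeResolution I) (D : ℕ) :
    ∀ i, Fin (coneRank G.rank F.rank i) → ℕ
  | 0 => G.deg 0
  | i + 1 => Fin.append (G.deg (i + 1)) fun e => F.deg i e + D

/-- The degree zero part of a mapping cone. -/
noncomputable def coneBase (F : GradedFreeResolution J) (G : GradedFreeResolution I) :
    (Fin (coneRank G.rank F.rank 0) → MvPolynomial (Fin n) k) ≃ₗ[MvPolynomial (Fin n) k]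
      (Fin (G.rank 0) → MvPolynomial (Fin n) k) :=
  LinearEquiv.refl _ _

/-- The positive degree parts of a mapping cone. -/
noncomputable def coneSplit (F : GradedFreeResolution J) (G : GradedFreeResolution I) (i : ℕ) :
    (Fin (coneRank G.rank F.rank (i + 1)) → MvPolynomial (Fin n) k) ≃ₗ[MvPolynomial (Fin n) k]
      (Fin (G.rank (i + 1)) → MvPolynomial (Fin n) k) × (Fin (F.rank i) → MvPolynomial (Fin n) k) :=
  splitVec k n (G.rank (i + 1)) (F.rank i)

theorem coneBase_mem_freeDegree (F : GradedFreeResolution J) (G : GradedFreeResolution I) {D m : ℕ}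
    {v : Fin (coneRank G.rank F.rank 0) → MvPolynomial (Fin n) k} :
    v ∈ freeDegree (k := k) (coneDeg F G D 0) m ↔
      coneBase F G v ∈ freeDegree (k := k) (G.deg 0) m := Iff.rfl

theorem coneSplit_mem_freeDegree (F : GradedFreeResolution J) (G : GradedFreeResolution I)
    {D i m : ℕ} {v : Fin (coneRank G.rank F.rank (i + 1)) → MvPolynomial (Fin n) k} :
    v ∈ freeDegree (k := k) (coneDeg F G D (i + 1)) m ↔
      (coneSplit F G i v).1 ∈ freeDegree (k := k) (G.deg (i + 1)) m ∧
        (coneSplit F G i v).2 ∈ freeDegree (k := k) (fun e => F.deg i e + D) m :=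
  splitVec_mem_freeDegree

/-- The differential of the mapping cone of `φ`. -/
noncomputable def coneD (F : GradedFreeResolution J) (G : GradedFreeResolution I)
    (φ : ∀ i, (Fin (F.rank i) → MvPolynomial (Fin n) k) →ₗ[MvPolynomial (Fin n) k]
      (Fin (G.rank i) → MvPolynomial (Fin n) k)) :
    ∀ i, (Fin (coneRank G.rank F.rank (i + 1)) → MvPolynomial (Fin n) k)
      →ₗ[MvPolynomial (Fin n) k] (Fin (coneRank G.rank F.rank i) → MvPolynomial (Fin n) k)
  | 0 => (coneBase F G).symm.toLinearMap.comp
      (((G.d 0).coprod (φ 0)).comp (coneSplit F G 0).toLinearMap)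
  | i + 1 => (coneSplit F G i).symm.toLinearMap.comp
      ((((G.d (i + 1)).coprod (φ (i + 1))).prod (-(F.d i).comp (LinearMap.snd _ _ _))).comp
        (coneSplit F G (i + 1)).toLinearMap)

theorem coneBase_coneD (F : GradedFreeResolution J) (G : GradedFreeResolution I)
    (φ : ∀ i, (Fin (F.rank i) → MvPolynomial (Fin n) k) →ₗ[MvPolynomial (Fin n) k]
      (Fin (G.rank i) → MvPolynomial (Fin n) k))
    (v : Fin (coneRank G.rank F.rank (0 + 1)) → MvPolynomial (Fin n) k) :
    coneBase F G (coneD F G φ 0 v) =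
      G.d 0 (coneSplit F G 0 v).1 + φ 0 (coneSplit F G 0 v).2 := rfl

theorem coneSplit_coneD (F : GradedFreeResolution J) (G : GradedFreeResolution I)
    (φ : ∀ i, (Fin (F.rank i) → MvPolynomial (Fin n) k) →ₗ[MvPolynomial (Fin n) k]
      (Fin (G.rank i) → MvPolynomial (Fin n) k)) (i : ℕ)
    (v : Fin (coneRank G.rank F.rank (i + 1 + 1)) → MvPolynomial (Fin n) k) :
    coneSplit F G i (coneD F G φ (i + 1) v) =
      (G.d (i + 1) (coneSplit F G (i + 1) v).1 + φ (i + 1) (coneSplit F G (i + 1) v).2,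
        -F.d i (coneSplit F G (i + 1) v).2) :=
  (coneSplit F G i).apply_symm_apply _

/-- If `J = I : p`, the mapping cone of a lift of multiplication by `p` resolves
`S ⧸ (I + (p))`. -/
theorem exists_cone (F : GradedFreeResolution J) (G : GradedFreeResolution I)
    (hI : ∀ p ∈ I, ∀ m, MvPolynomial.homogeneousComponent m p ∈ I) {D : ℕ}
    {p : MvPolynomial (Fin n) k} (hp : p.IsHomogeneous D) (hpJ : ∀ q, q ∈ J ↔ p * q ∈ I) :
    ∃ C : GradedFreeResolution (I ⊔ Ideal.span {p}),
      ∃ h : C.rank = coneRank G.rank F.rank,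
        ∀ i e, C.deg i e = coneDeg F G D i (Fin.cast (congrFun h i) e) := by
  obtain ⟨φ, hφ, hd, h0⟩ := F.exists_chainMap G hI hp fun q => (hpJ q).1
  have hle : I ≤ I ⊔ Ideal.span {p} := le_sup_left
  let π : (MvPolynomial (Fin n) k ⧸ I) →ₗ[MvPolynomial (Fin n) k]
      (MvPolynomial (Fin n) k ⧸ I ⊔ Ideal.span {p}) :=
    Submodule.mapQ I (I ⊔ Ideal.span {p}) LinearMap.id hle
  have hπ : ∀ q, π (Ideal.Quotient.mk I q) = Ideal.Quotient.mk (I ⊔ Ideal.span {p}) q :=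
    fun q => rfl
  refine ⟨{
    rank := coneRank G.rank F.rank
    deg := coneDeg F G D
    d := coneD F G φ
    aug := (π.comp G.aug).comp (coneBase F G).toLinearMap
    d_degree := ?_
    aug_degree := ?_
    aug_surjective := ?_
    exact_zero := ?_
    exact_succ := ?_ }, rfl, fun i e => rfl⟩
  · intro i m v hv
    rw [coneSplit_mem_freeDegree] at hv
    obtain ⟨h1, h2⟩ := hv
    cases i with
    | zero =>
      rw [coneBase_mem_freeDegree, coneBase_coneD]
      exact add_mem (G.d_degree 0 m _ h1) (hφ 0 m _ h2)
    | succ i =>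
      rw [coneSplit_mem_freeDegree, coneSplit_coneD]
      refine ⟨add_mem (G.d_degree _ m _ h1) (hφ _ m _ h2), neg_mem ?_⟩
      refine map_mem_freeDegree_of_single (deg := fun e => F.deg (i + 1) e + D) ?_ m _ h2
      intro e f s hs
      have := F.d_degree i _ _ (single_mem_freeDegree _ e) f s hs
      dsimp only
      omega
  · intro m v hv
    obtain ⟨q, hq, hq'⟩ := G.aug_degree m _ ((coneBase_mem_freeDegree F G).1 hv)
    replace hq' : Ideal.Quotient.mk I q = _ := hq'
    refine ⟨q, hq, ?_⟩
    change Ideal.Quotient.mk (I ⊔ Ideal.span {p}) q = π (G.aug (coneBase F G v))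
    rw [← hq', hπ]
  · intro y
    obtain ⟨q, rfl⟩ := Ideal.Quotient.mk_surjective y
    obtain ⟨v, hv⟩ := G.aug_surjective (Ideal.Quotient.mk I q)
    refine ⟨(coneBase F G).symm v, ?_⟩
    change π (G.aug (coneBase F G ((coneBase F G).symm v))) = _
    rw [LinearEquiv.apply_symm_apply, hv, hπ]
  · intro v
    change π (G.aug (coneBase F G v)) = 0 ↔ ∃ u, coneD F G φ 0 u = v
    obtain ⟨q, hq⟩ := Ideal.Quotient.mk_surjective (G.aug (coneBase F G v))
    rw [← hq, hπ, Ideal.Quotient.eq_zero_iff_mem]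
    constructor
    · intro h
      obtain ⟨x, hx, y, hy, rfl⟩ := Submodule.mem_sup.1 h
      obtain ⟨a, rfl⟩ := Ideal.mem_span_singleton'.1 hy
      obtain ⟨w, hw⟩ := F.aug_surjective (Ideal.Quotient.mk J a)
      -- If v represents x + a p with x in I, subtracting φ applied to a lift of a leaves a
      -- representative of x, hence a boundary of G.
      have h1 : G.aug (coneBase F G v - φ 0 w) = 0 := by
        rw [map_sub, h0 w a hw, ← hq, ← map_sub, Ideal.Quotient.eq_zero_iff_mem]
        convert hx using 1
        ring
      obtain ⟨u, hu⟩ := (G.exact_zero _).1 h1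
      refine ⟨(coneSplit F G 0).symm (u, w), (coneBase F G).injective ?_⟩
      rw [coneBase_coneD, LinearEquiv.apply_symm_apply, hu]
      exact sub_add_cancel _ _
    · rintro ⟨u, rfl⟩
      obtain ⟨a, ha⟩ := Ideal.Quotient.mk_surjective (F.aug (coneSplit F G 0 u).2)
      rw [coneBase_coneD, map_add, G.aug_d, zero_add, h0 _ a ha.symm, Ideal.Quotient.eq] at hq
      rw [show q = (q - p * a) + a * p by ring]
      exact Submodule.add_mem_sup hq (Ideal.mem_span_singleton'.2 ⟨a, rfl⟩)
  · intro i v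
    change _ ↔ ∃ u, coneD F G φ (i + 1) u = v
    constructor
    · intro hv
      -- The F-component of a cycle is a boundary of F. For i = 0 this is where the inclusion I : p
      -- ⊆ J enters; the opposite inclusion already gave the chain map.
      have key : (∃ w, -F.d i w = (coneSplit F G i v).2) ∧
          G.d i (coneSplit F G i v).1 + φ i (coneSplit F G i v).2 = 0 := by
        cases i with
        | zero =>
          have h2 := coneBase_coneD F G φ v
          rw [hv, map_zero] at h2
          refine ⟨?_, h2.symm⟩
          obtain ⟨a, ha⟩ := Ideal.Quotient.mk_surjective (F.aug (coneSplit F G 0 v).2)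
          have h1 := congrArg G.aug h2
          rw [map_add, G.aug_d, zero_add, h0 _ a ha.symm, map_zero, eq_comm,
            Ideal.Quotient.eq_zero_iff_mem, ← hpJ, ← Ideal.Quotient.eq_zero_iff_mem, ha] at h1
          obtain ⟨w, hw⟩ := (F.exact_zero _).1 h1
          exact ⟨-w, by rw [map_neg, neg_neg, hw]⟩
        | succ i =>
          have h2 := coneSplit_coneD F G φ i v
          rw [hv, map_zero] at h2
          refine ⟨?_, (congrArg Prod.fst h2).symm⟩
          have h1 := congrArg Prod.snd h2
          rw [Prod.snd_zero, eq_comm, neg_eq_zero] at h1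
          obtain ⟨w, hw⟩ := (F.exact_succ _ _).1 h1
          exact ⟨-w, by rw [map_neg, neg_neg, hw]⟩
      obtain ⟨⟨w, hw⟩, hv'⟩ := key
      have h2 : G.d i ((coneSplit F G i v).1 - φ (i + 1) w) = 0 := by
        rw [map_sub, hd, sub_eq_add_neg, ← map_neg, hw, hv']
      obtain ⟨u, hu⟩ := (G.exact_succ _ _).1 h2
      refine ⟨(coneSplit F G (i + 1)).symm (u, w), (coneSplit F G i).injective ?_⟩
      rw [coneSplit_coneD, LinearEquiv.apply_symm_apply, hu, hw, sub_add_cancel]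
    · rintro ⟨u, rfl⟩
      cases i with
      | zero =>
        apply (coneBase F G).injective
        rw [coneBase_coneD, coneSplit_coneD, map_add, G.d_d, map_neg, zero_add, hd,
          add_neg_cancel, map_zero]
      | succ i =>
        apply (coneSplit F G i).injective
        rw [coneSplit_coneD, coneSplit_coneD, map_add, G.d_d, map_neg, zero_add, hd, map_neg,
          F.d_d, add_neg_cancel, neg_zero, neg_zero, map_zero, Prod.mk_zero_zero]

/-- The resolution of `S` by itself. -/
theorem exists_bot : ∃ C : GradedFreeResolution (⊥ : Ideal (MvPolynomial (Fin n) k)),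
    C.rank = (fun i => if i = 0 then 1 else 0) ∧ ∀ e, C.deg 0 e = 0 := by
  refine ⟨{
    rank := fun i => if i = 0 then 1 else 0
    deg := fun _ _ => 0
    d := fun _ => 0
    aug := (Submodule.mkQ _).comp (LinearMap.proj (0 : Fin 1))
    d_degree := fun i m v _ => zero_mem _
    aug_degree := ?_
    aug_surjective := ?_
    exact_zero := ?_
    exact_succ := ?_ }, rfl, fun _ => rfl⟩
  · intro m v hv
    refine ⟨v (0 : Fin 1), ?_, rfl⟩
    intro s hs
    have h : s.degree = m := hv (0 : Fin 1) s (MvPolynomial.mem_support_iff.2 hs)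
    rw [← h, Finsupp.degree_eq_weight_one]
    rfl
  · intro y
    obtain ⟨p, rfl⟩ := Ideal.Quotient.mk_surjective y
    exact ⟨fun _ => p, rfl⟩
  · intro v
    refine (Submodule.Quotient.mk_eq_zero _).trans ?_
    rw [Submodule.mem_bot]
    constructor
    · intro h
      refine ⟨0, ?_⟩
      funext e
      rw [show e = (0 : Fin 1) from Subsingleton.elim (α := Fin 1) _ _]
      exact h.symm
    · rintro ⟨w, rfl⟩
      rfl
  · intro i v
    have : v = 0 := funext fun e => absurd e.2 (by simp)
    subst this
    exact ⟨fun _ => ⟨0, rfl⟩, fun _ => rfl⟩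

/-- `S ⧸ I` has a resolution with ranks `ρ i` in which the basis elements in homological degree
`i > 0` all have degree `i + c`. -/
def HasLinearResolution (I : Ideal (MvPolynomial (Fin n) k)) (c : ℕ) (ρ : ℕ → ℕ) : Prop :=
  ∃ G : GradedFreeResolution I, G.rank = ρ ∧ ∀ i e, G.deg i e = if i = 0 then 0 else i + c

theorem hasLinearResolution_bot (c : ℕ) :
    HasLinearResolution (⊥ : Ideal (MvPolynomial (Fin n) k)) c (fun i => if i = 0 then 1 else 0) := by
  obtain ⟨C, h, h'⟩ := exists_bot (k := k) (n := n)
  refine ⟨C, h, fun i e => ?_⟩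
  rcases eq_or_ne i 0 with rfl | hi
  · exact h' e
  · exact absurd e.2 (by simp [h, hi])

/-- The generators of F in homological degree i have degree i, the constant for J being 0. The cone
moves them to homological degree i+1 and degree i + (c+1) = (i+1) + c, so linearity persists. -/
theorem HasLinearResolution.sup_span_singleton {c : ℕ} {ρ σ : ℕ → ℕ}
    (hG : HasLinearResolution I c ρ) (hF : HasLinearResolution J 0 σ)
    (hI : ∀ p ∈ I, ∀ m, MvPolynomial.homogeneousComponent m p ∈ I)
    {p : MvPolynomial (Fin n) k} (hp : p.IsHomogeneous (c + 1))
    (hpJ : ∀ q, q ∈ J ↔ p * q ∈ I) :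
    HasLinearResolution (I ⊔ Ideal.span {p}) c (coneRank ρ σ) := by
  obtain ⟨G, rfl, hG⟩ := hG
  obtain ⟨F, rfl, hF⟩ := hF
  obtain ⟨C, h, h'⟩ := F.exists_cone G hI hp hpJ
  refine ⟨C, h, fun i e => ?_⟩
  rw [h']
  generalize Fin.cast (congrFun h i) e = e
  cases i with
  | zero => exact hG 0 e
  | succ i =>
    change Fin (G.rank (i + 1) + F.rank i) at e
    change Fin.append _ _ e = _
    rw [if_neg i.succ_ne_zero]
    induction e using Fin.addCases with
    | left e => rw [Fin.append_left, hG, if_neg i.succ_ne_zero]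
    | right e =>
      rw [Fin.append_right, hF]
      by_cases hi : i = 0 <;> simp only [hi, if_true, if_false] <;> omega

/-- A linear resolution is minimal: basis degrees strictly increase from each homological degree to
the next, so no entry of a differential has a constant term. -/
theorem HasLinearResolution.gradedBetti_eq {c : ℕ} {ρ : ℕ → ℕ}
    (h : HasLinearResolution I c ρ)
    (hI : ∀ p ∈ I, ∀ m, MvPolynomial.homogeneousComponent m p ∈ I) (i j : ℕ) :
    gradedBetti I hI i j = if j = (if i = 0 then 0 else i + c) then ρ i else 0 := by
  obtain ⟨G, rfl, hG⟩ := h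
  have hmin : ∀ i v, constVec (G.d i v) = 0 := by
    intro i v
    rw [map_eq_sum_smul_single (G.d i) v]
    ext f
    rw [constVec_apply, Finset.sum_apply, map_sum]
    refine Finset.sum_eq_zero fun e _ => ?_
    rw [Pi.smul_apply, smul_eq_mul, map_mul, ← constVec_apply (G.d i _),
      constVec_apply_eq_zero (G.d_degree i _ _ (single_mem_freeDegree _ e)), mul_zero]
    rw [hG, hG, if_neg i.succ_ne_zero]
    by_cases hi : i = 0 <;> simp only [hi, if_true, if_false] <;> omega
  rw [gradedBetti, finrank_torDegree_eq_card _ G hI hmin]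
  simp only [hG]
  rcases eq_or_ne j (if i = 0 then 0 else i + c) with rfl | h
  · simp
  · simp [h, h.symm]

end GradedFreeResolution

/-! ### Monomial ideals, linear quotients and the count of ranks. -/

section MonomialIdeals

open GradedFreeResolution

variable {n : ℕ}

/-- The ideal generated by the monomials with exponents in `A`. -/
noncomputable def monomialIdeal (k : Type*) [Field k] (A : Set (Fin n →₀ ℕ)) :
    Ideal (MvPolynomial (Fin n) k) :=
  Ideal.span ((fun s => MvPolynomial.monomial s 1) '' A)

variable {k : Type*} [Field k]

theorem mem_monomialIdeal {A : Set (Fin n →₀ ℕ)} {p : MvPolynomial (Fin n) k} :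
    p ∈ monomialIdeal k A ↔ ∀ x ∈ p.support, ∃ t ∈ A, t ≤ x :=
  MvPolynomial.mem_ideal_span_monomial_image

theorem monomialIdeal_homogeneous (A : Set (Fin n →₀ ℕ)) :
    ∀ p ∈ monomialIdeal k A, ∀ m, MvPolynomial.homogeneousComponent m p ∈ monomialIdeal k A := by
  intro p hp m
  rw [mem_monomialIdeal] at hp ⊢
  intro s hs
  rw [MvPolynomial.support_homogeneousComponent, Finset.mem_filter] at hs
  exact hp s hs.1

theorem monomialIdeal_insert (s : Fin n →₀ ℕ) (A : Set (Fin n →₀ ℕ)) :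
    monomialIdeal k (insert s A) =
      monomialIdeal k A ⊔ Ideal.span {MvPolynomial.monomial s (1 : k)} := by
  rw [monomialIdeal, Set.image_insert_eq, Set.insert_eq, Ideal.span_union, sup_comm]
  rfl

theorem monomial_mul_mem_monomialIdeal {A : Set (Fin n →₀ ℕ)} {s : Fin n →₀ ℕ}
    {q : MvPolynomial (Fin n) k} :
    MvPolynomial.monomial s 1 * q ∈ monomialIdeal k A ↔
      ∀ x ∈ q.support, ∃ t ∈ A, t ≤ s + x := by
  rw [mem_monomialIdeal]
  constructor
  · intro h x hx
    refine h _ ?_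
    rwa [MvPolynomial.mem_support_iff, MvPolynomial.coeff_monomial_mul, one_mul,
      ← MvPolynomial.mem_support_iff]
  · intro h y hy
    rw [MvPolynomial.mem_support_iff, MvPolynomial.coeff_monomial_mul', one_mul] at hy
    split_ifs at hy with hs
    · obtain ⟨t, ht, hle⟩ := h _ (MvPolynomial.mem_support_iff.2 hy)
      exact ⟨t, ht, by rwa [add_tsub_cancel_of_le hs] at hle⟩
    · exact absurd rfl hy

theorem HasLinearResolution.insert_monomial {A B : Set (Fin n →₀ ℕ)} {c : ℕ} {ρ σ : ℕ → ℕ}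
    (hA : HasLinearResolution (monomialIdeal k A) c ρ)
    (hB : HasLinearResolution (monomialIdeal k B) 0 σ) {s : Fin n →₀ ℕ} (hs : s.degree = c + 1)
    (h : ∀ x, (∃ t ∈ B, t ≤ x) ↔ ∃ t ∈ A, t ≤ s + x) :
    HasLinearResolution (monomialIdeal k (insert s A)) c (coneRank ρ σ) := by
  rw [monomialIdeal_insert]
  refine hA.sup_span_singleton hB (monomialIdeal_homogeneous A)
    (MvPolynomial.isHomogeneous_monomial _ hs) fun q => ?_
  rw [monomial_mul_mem_monomialIdeal, mem_monomialIdeal]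
  simp only [h]

theorem monomialIdeal_empty : monomialIdeal k (∅ : Set (Fin n →₀ ℕ)) = ⊥ := by
  simp [monomialIdeal]

/-- A new variable is a nonzerodivisor modulo the old ones, so the colon ideal is the old ideal
itself. The cone therefore uses `ih` twice, and the ranks add by Pascal's rule. -/
theorem hasLinearResolution_variables (T : Finset (Fin n)) :
    HasLinearResolution (monomialIdeal k ((fun l => Finsupp.single l 1) '' (T : Set (Fin n)))) 0
      (fun i => T.card.choose i) := by
  classical
  induction T using Finset.induction_on with
  | empty =>
    rw [Finset.coe_empty, Set.image_empty, monomialIdeal_empty]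
    convert hasLinearResolution_bot (k := k) (n := n) 0 using 2 with i
    cases i <;> simp
  | insert a T ha ih =>
    rw [Finset.coe_insert, Set.image_insert_eq]
    convert HasLinearResolution.insert_monomial ih ih (s := Finsupp.single a 1) (by simp) ?_ using 1
    · funext i
      rw [Finset.card_insert_of_notMem ha]
      cases i with
      | zero => simp [coneRank]
      | succ i => rw [Nat.choose_succ_succ', add_comm]; rfl
    · intro x
      simp only [Set.exists_mem_image]
      refine exists_congr fun l => and_congr_right fun hl => ?_
      have : a ≠ l := fun h => ha (h ▸ hl)
      simp [this]

theorem single_add_single_le_iff {i l : Fin n} (h : i ≠ l) (x : Fin n →₀ ℕ) :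
    Finsupp.single i 1 + Finsupp.single l 1 ≤ x ↔ 1 ≤ x i ∧ 1 ≤ x l := by
  constructor
  · intro hx
    have h1 := hx i
    have h2 := hx l
    rw [Finsupp.add_apply, Finsupp.single_eq_same] at h1
    rw [Finsupp.add_apply, Finsupp.single_eq_same (a := l)] at h2
    omega
  · rintro ⟨h1, h2⟩ j
    rw [Finsupp.add_apply, Finsupp.single_apply, Finsupp.single_apply]
    split_ifs with ha hb hb
    · exact absurd (ha.trans hb.symm) h
    · exact ha ▸ h1
    · exact hb ▸ h2
    · exact Nat.zero_le _

/-- The exponents of the products `x_i x_l` with `i < l` and either `i < P`, `l < b` or `i = P`,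
`l < J`. -/
def initialSegment (n b P J : ℕ) : Set (Fin n →₀ ℕ) :=
  {s | ∃ i l : Fin n, i < l ∧ (i.val < P ∧ l.val < b ∨ i.val = P ∧ l.val < J) ∧
    s = Finsupp.single i 1 + Finsupp.single l 1}

theorem initialSegment_zero_zero (n b : ℕ) : initialSegment n b 0 0 = ∅ := by
  ext s
  simp [initialSegment]

theorem initialSegment_succ_self (n b P : ℕ) :
    initialSegment n b P (P + 1) = initialSegment n b P 0 := by
  ext s
  refine exists_congr fun i => exists_congr fun l => and_congr_right fun h => and_congr_left' ?_
  have := Fin.lt_def.1 h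
  omega

theorem initialSegment_self (n b P : ℕ) :
    initialSegment n b P b = initialSegment n b (P + 1) 0 := by
  ext s
  refine exists_congr fun i => exists_congr fun l => and_congr_right fun h => and_congr_left' ?_
  omega

theorem initialSegment_succ {n b P J : ℕ} (hPJ : P < J) (hJb : J < b) (hbn : b ≤ n) :
    initialSegment n b P (J + 1) =
      insert (Finsupp.single ⟨P, by omega⟩ 1 + Finsupp.single ⟨J, by omega⟩ 1)
        (initialSegment n b P J) := by
  ext s
  constructor
  · rintro ⟨i, l, hil, h, rfl⟩
    by_cases hl : i.val = P ∧ l.val = J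
    · left
      obtain ⟨rfl, rfl⟩ := hl
      rfl
    · right
      exact ⟨i, l, hil, by omega, rfl⟩
  · rintro (rfl | ⟨i, l, hil, h, rfl⟩)
    · exact ⟨_, _, hPJ, by simp, rfl⟩
    · exact ⟨i, l, hil, by omega, rfl⟩

/-- For l < P the earlier generator x_l x_J shows that x_l is in the colon ideal; for P < l < J the
generator x_P x_l does. Conversely, an earlier generator has either i < P, or i = P and P < l < J;
then x_i, respectively x_l, is coprime to x_P x_J and must divide x. -/
theorem initialSegment_colon {n b P J : ℕ} (hPJ : P < J) (hJb : J < b) (hbn : b ≤ n)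
    (x : Fin n →₀ ℕ) :
    (∃ t ∈ (fun l : Fin n => Finsupp.single l 1) ''
      ((Finset.univ.filter fun l : Fin n => l.val < J ∧ l.val ≠ P : Finset (Fin n)) : Set (Fin n)),
      t ≤ x) ↔
    ∃ t ∈ initialSegment n b P J,
      t ≤ Finsupp.single ⟨P, by omega⟩ 1 + Finsupp.single ⟨J, by omega⟩ 1 + x := by
  simp only [Set.exists_mem_image, Finset.coe_filter, Finset.mem_univ, true_and,
    Set.mem_ofPred_eq, Finsupp.single_le_iff]
  have hval : ∀ l : Fin n, (Finsupp.single ⟨P, by omega⟩ 1 +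
      Finsupp.single ⟨J, by omega⟩ 1 + x : Fin n →₀ ℕ) l =
      (if P = l.val then 1 else 0) + (if J = l.val then 1 else 0) + x l := by
    intro l
    simp only [Finsupp.add_apply, Finsupp.single_apply, Fin.ext_iff]
  constructor
  · rintro ⟨l, ⟨hlJ, hlP⟩, hl⟩
    rcases lt_or_gt_of_ne hlP with h | h
    · refine ⟨_, ⟨l, ⟨J, by omega⟩, hlJ, Or.inl ⟨h, hJb⟩, rfl⟩, ?_⟩
      rw [single_add_single_le_iff (Fin.ne_of_lt hlJ), hval, hval]
      simp only [if_true]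
      omega
    · refine ⟨_, ⟨⟨P, by omega⟩, l, h, Or.inr ⟨rfl, hlJ⟩, rfl⟩, ?_⟩
      rw [single_add_single_le_iff (Fin.ne_of_lt h), hval, hval]
      simp only [if_true]
      omega
  · rintro ⟨_, ⟨i, l, hil, h, rfl⟩, ht⟩
    rw [single_add_single_le_iff hil.ne, hval, hval] at ht
    have := Fin.lt_def.1 hil
    rcases h with h | h
    · refine ⟨i, by omega, ?_⟩
      rw [if_neg (by omega), if_neg (by omega)] at ht
      omega
    · refine ⟨l, by omega, ?_⟩
      rw [if_neg (c := P = l.val) (by omega), if_neg (c := J = l.val) (by omega)] at ht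
      omega

theorem card_filter_lt_ne {n P J : ℕ} (hPJ : P < J) (hJn : J < n) :
    (Finset.univ.filter fun l : Fin n => l.val < J ∧ l.val ≠ P).card = J - 1 := by
  have : (Finset.univ.filter fun l : Fin n => l.val < J ∧ l.val ≠ P) =
      (Finset.Iio (⟨J, hJn⟩ : Fin n)).erase ⟨P, by omega⟩ := by
    ext l
    simp only [Finset.mem_filter, Finset.mem_univ, true_and, Finset.mem_erase, Finset.mem_Iio,
      Fin.lt_def, ne_eq, Fin.ext_iff]
    exact and_comm
  have hmem : (⟨P, by omega⟩ : Fin n) ∈ Finset.Iio (⟨J, hJn⟩ : Fin n) :=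
    Finset.mem_Iio.2 (Fin.lt_def.2 hPJ)
  rw [this, Finset.card_erase_of_mem hmem, Fin.card_Iio]

theorem hasLinearResolution_initialSegment {b : ℕ} (hbn : b ≤ n) {P : ℕ} (hP : P ≤ b) :
    ∃ ρ : ℕ → ℕ, HasLinearResolution (monomialIdeal k (initialSegment n b P 0)) 1 ρ ∧ ρ 0 = 1 ∧
      ∀ i, (ρ (i + 1) : ℤ) = P * (b - 1).choose (i + 1) - P.choose (i + 2) := by
  induction P with
  | zero =>
    rw [initialSegment_zero_zero, monomialIdeal_empty]
    exact ⟨_, hasLinearResolution_bot 1, by simp, fun i => by simp⟩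
  | succ P ih =>
    -- Row P is filled by inserting x_P x_J for increasing J. The added term is the sum of C(J'-1,
    -- i) over P < J' < J, summed by the hockey-stick identity.
    have key : ∀ J, P + 1 ≤ J → J ≤ b → ∃ ρ : ℕ → ℕ,
        HasLinearResolution (monomialIdeal k (initialSegment n b P J)) 1 ρ ∧ ρ 0 = 1 ∧
        ∀ i, (ρ (i + 1) : ℤ) = P * (b - 1).choose (i + 1) - P.choose (i + 2) +
          ((J - 1).choose (i + 1) - P.choose (i + 1)) := by
      intro J hJ
      induction J, hJ using Nat.le_induction with
      | base =>
        intro _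
        obtain ⟨ρ, h1, h2, h3⟩ := ih (by omega)
        rw [initialSegment_succ_self]
        exact ⟨ρ, h1, h2, fun i => by rw [h3, Nat.add_sub_cancel, sub_self, add_zero]⟩
      | succ J hJ ihJ =>
        intro hJb
        obtain ⟨ρ, h1, h2, h3⟩ := ihJ (by omega)
        rw [initialSegment_succ (by omega) (by omega) hbn]
        refine ⟨_, HasLinearResolution.insert_monomial h1 (hasLinearResolution_variables _)
          (by simp) (initialSegment_colon (by omega) (by omega) hbn), h2, fun i => ?_⟩
        rw [card_filter_lt_ne (by omega) (by omega)]
        change ((ρ (i + 1) + (J - 1).choose i : ℕ) : ℤ) = _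
        obtain ⟨J, rfl⟩ : ∃ J', J = J' + 1 := ⟨J - 1, by omega⟩
        rw [Nat.cast_add, h3, Nat.add_sub_cancel, Nat.add_sub_cancel, Nat.choose_succ_succ' J i]
        push_cast
        ring
    obtain ⟨ρ, h1, h2, h3⟩ := key b hP le_rfl
    rw [initialSegment_self] at h1
    refine ⟨ρ, h1, h2, fun i => ?_⟩
    rw [h3, Nat.choose_succ_succ' P (i + 1)]
    push_cast
    ring

/-! ### The lexicographic segment in terms of pairs of indices. -/

theorem exists_eq_single_add_single {s : Fin n →₀ ℕ} (hs : s.degree = 2) (h : ∀ i, s i ≤ 1) :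
    ∃ i l : Fin n, i < l ∧ s = Finsupp.single i 1 + Finsupp.single l 1 := by
  classical
  have h1 : ∀ i ∈ s.support, s i = 1 := fun i hi => by
    have := h i
    have := Finsupp.mem_support_iff.1 hi
    omega
  have h2 : s = ∑ i ∈ s.support, Finsupp.single i 1 := by
    conv_lhs => rw [← Finsupp.sum_single s, Finsupp.sum]
    exact Finset.sum_congr rfl fun i hi => by rw [h1 i hi]
  have h3 : s.support.card = 2 := by
    rw [← hs, Finsupp.degree_apply, Finset.card_eq_sum_ones]
    exact Finset.sum_congr rfl fun i hi => (h1 i hi).symm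
  obtain ⟨i, l, hil, hsupp⟩ := Finset.card_eq_two.1 h3
  rw [hsupp, Finset.sum_pair hil] at h2
  rcases lt_or_gt_of_ne hil with hlt | hlt
  · exact ⟨i, l, hlt, h2⟩
  · exact ⟨l, i, hlt, h2.trans (add_comm _ _)⟩

/-- The first index at which the exponents differ decides. If i ≠ a, this is the smaller of i and a;
if i = a, then l ≤ b already gives the inequality. -/
theorem toLex_le_toLex_iff {a b i l : Fin n} (hab : a ≤ b) (hil : i < l) (hlb : l ≤ b) :
    toLex (Finsupp.single a 1 + Finsupp.single b 1 : Fin n →₀ ℕ) ≤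
      toLex (Finsupp.single i 1 + Finsupp.single l 1) ↔ i ≤ a := by
  constructor
  · intro h
    by_contra! hai
    refine absurd h (not_le.2 (Finsupp.Lex.lt_iff.2 ⟨a, fun j hj => ?_, ?_⟩))
    · simp [hj.ne', (hj.trans hai).ne', (hj.trans_le hab).ne',
        (hj.trans (hai.trans hil)).ne']
    · simp [Finsupp.single_apply, hai.ne', (hai.trans hil).ne']
  · intro hia
    rcases hia.lt_or_eq with hia | rfl
    · refine le_of_lt (Finsupp.Lex.lt_iff.2 ⟨i, fun j hj => ?_, ?_⟩)
      · simp [hj.ne', (hj.trans hia).ne', (hj.trans hil).ne',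
          (hj.trans (hil.trans_le hlb)).ne']
      · simp [hia.ne', hil.ne', (hil.trans_le hlb).ne']
    · rcases hlb.lt_or_eq with hlb | rfl
      · refine le_of_lt (Finsupp.Lex.lt_iff.2 ⟨l, fun j hj => ?_, ?_⟩)
        · simp [Finsupp.single_apply, hj.ne', (hj.trans hlb).ne']
        · simp [hil.ne, hlb.ne']
      · exact le_rfl

theorem lexSegment_eq_initialSegment {a b : Fin n} (hab : a ≤ b) :
    lexSegment a b = initialSegment n (b.val + 1) (a.val + 1) 0 := by
  ext s
  constructor
  · rintro ⟨hs, h1, hb, hle⟩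
    obtain ⟨i, l, hil, rfl⟩ := exists_eq_single_add_single hs h1
    have hlb : l ≤ b := hb l (by simp)
    rw [toLex_le_toLex_iff hab hil hlb] at hle
    refine ⟨i, l, hil, Or.inl ⟨?_, ?_⟩, rfl⟩
    · exact Nat.lt_succ_of_le hle
    · exact Nat.lt_succ_of_le hlb
  · rintro ⟨i, l, hil, h | h, rfl⟩
    · have hlb : l ≤ b := Nat.le_of_lt_succ h.2
      have hia : i ≤ a := Nat.le_of_lt_succ h.1
      refine ⟨by simp, fun j => ?_, fun j hj => ?_, (toLex_le_toLex_iff hab hil hlb).2 hia⟩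
      · rw [Finsupp.add_apply, Finsupp.single_apply, Finsupp.single_apply]
        split_ifs with h1 h2
        · exact absurd (h1.trans h2.symm) hil.ne
        all_goals omega
      · rw [Finsupp.mem_support_iff, Finsupp.add_apply, Finsupp.single_apply,
          Finsupp.single_apply] at hj
        split_ifs at hj with h1 h2 h2
        · exact h2 ▸ hlb
        · exact h1 ▸ hil.le.trans hlb
        · exact h2 ▸ hlb
        · exact absurd rfl hj
    · exact absurd h.2 (Nat.not_lt_zero _)

end MonomialIdeals

/-! ### The Betti numbers of L(a,b). -/

open GradedFreeResolution in
theorem mainTheorem6 (k : Type*) [Field k] (n a b : ℕ) (ha : 1 ≤ a) (hab : a ≤ b) (hbn : b ≤ n) :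
    (∀ i, 1 ≤ i → i ≤ b - 1 →
      (gradedBetti
          (lexIdeal k (varIndex a ha (hab.trans hbn)) (varIndex b (ha.trans hab) hbn))
          (lexIdeal_homogeneous k _ _) i (i + 1) : ℤ) =
        a * (b.choose (i + 1) : ℤ) - a * ((b - 1).choose (i + 1) : ℤ) - (a.choose (i + 1) : ℤ)) ∧
    gradedBetti
        (lexIdeal k (varIndex a ha (hab.trans hbn)) (varIndex b (ha.trans hab) hbn))
        (lexIdeal_homogeneous k _ _) 0 0 = 1 ∧
    (∀ i j, (i, j) ≠ (0, 0) → ¬ (1 ≤ i ∧ i ≤ b - 1 ∧ j = i + 1) →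
      gradedBetti
        (lexIdeal k (varIndex a ha (hab.trans hbn)) (varIndex b (ha.trans hab) hbn))
        (lexIdeal_homogeneous k _ _) i j = 0) := by
  obtain ⟨ρ, h1, h2, h3⟩ := hasLinearResolution_initialSegment (k := k) hbn hab
  have hle : varIndex a ha (hab.trans hbn) ≤ varIndex b (ha.trans hab) hbn :=
    Nat.sub_le_sub_right hab 1
  have hI : lexIdeal k (varIndex a ha (hab.trans hbn)) (varIndex b (ha.trans hab) hbn) =
      monomialIdeal k (initialSegment n b a 0) := by
    rw [lexIdeal, lexSegment_eq_initialSegment hle]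
    simp only [varIndex]
    rw [Nat.sub_add_cancel ha, Nat.sub_add_cancel (ha.trans hab)]
    rfl
  rw [← hI] at h1
  refine ⟨fun i hi hib => ?_, ?_, fun i j hij hij' => ?_⟩
  · obtain ⟨i, rfl⟩ : ∃ i', i = i' + 1 := ⟨i - 1, by omega⟩
    obtain ⟨b, rfl⟩ : ∃ b', b = b' + 1 := ⟨b - 1, by omega⟩
    rw [h1.gradedBetti_eq, if_neg i.succ_ne_zero, if_pos rfl, h3, Nat.choose_succ_succ' b (i + 1),
      Nat.add_sub_cancel]
    push_cast
    ring
  · rw [h1.gradedBetti_eq, if_pos rfl, if_pos rfl, h2]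
  · rw [h1.gradedBetti_eq]
    cases i with
    | zero =>
      rw [if_pos rfl, if_neg]
      rintro rfl
      exact hij rfl
    | succ i =>
      rw [if_neg i.succ_ne_zero]
      split_ifs with hj
      -- On the linear strand beyond b - 1, both binomials in the rank formula vanish, the second
      -- because a ≤ b < i + 2.
      · have hlt : b - 1 < i + 1 := by
          by_contra! h
          exact hij' ⟨by omega, h, hj⟩
        have h4 := h3 i
        rw [Nat.choose_eq_zero_of_lt hlt, Nat.choose_eq_zero_of_lt (by omega)] at h4
        simpa using h4
      · rfl
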